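/- Let $m\ge 3$ and let $V_m=\{0,1\}^m\setminus\{0\}$. For an invertible transformation $T:X\to X$ and real-valued functions $(f_\epsilon)_{\epsilon\in V_m}$ on $X$, define the averages on $m$-dimensional cubes by $$\tilde K_m\big((f_\epsilon)_{\epsilon\in V_m},N\big)(x)=\frac1{N^m}\sum_{\vec i\in\{1,\dots,N\}^m}\ \prod_{\epsilon\in V_m} f_\epsilon\big(T^{\vec i\cdot\epsilon}x\big),\qquad N\ge1,$$ where $\vec i\cdot\epsilon=\sum_{j=1}^m i_j\epsilon_j$. Let $0<p<\frac{2^{m-1}+1}{m+1}$. Let $(X,\Sigma,\mu,T)$ be an ergodic dynamical system on a nonatomic probability space, i.e. $\mu$ is a probability measure such that every measurable set of positive measure has a measurable subset of strictly smaller positive measure, and $T:X\to X$ is an invertible, bimeasurable, $\mu$-preserving, ergodic transformation. Then there are $2^m-1$ real-valued functions $F_\epsilon\in L^p(X,\mu)$, $\epsilon\in V_m$, such that $$\limsup_{N\to\infty}\tilde K_m\big((F_\epsilon)_{\epsilon\in V_m},N\big)(x)=\infty\qquad\text{for }\mu\text{-a.e. }x\in X.$$ -/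

import Mathlib

open MeasureTheory Filter

/-- The set `V_m = {0,1}^m \ {0}` of nonzero vectors with entries in `{0,1}`. -/
abbrev CubeVertex (m : ℕ) : Type := {ε : Fin m → Fin 2 // ε ≠ 0}

/-- The dot product `i ⬝ ε = i_1 ε_1 + ⋯ + i_m ε_m`. -/
def cubeDot {m : ℕ} (i : Fin m → ℕ) (ε : CubeVertex m) : ℕ :=
  ∑ j, i j * (ε.1 j : ℕ)

/-- The average on `m`-dimensional cubes of a family `f` of functions indexed by `V_m`:
`N^{-m} ∑_{i ∈ {1, …, N}^m} ∏_{ε ∈ V_m} f_ε (T^{i ⬝ ε} x)`. -/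
noncomputable def cubeAverage {X : Type*} (T : X → X) (m : ℕ) (f : CubeVertex m → X → ℝ)
    (N : ℕ) (x : X) : ℝ :=
  (1 / (N : ℝ) ^ m) *
    ∑ i ∈ Fintype.piFinset (fun _ : Fin m => Finset.Icc 1 N),
      ∏ ε : CubeVertex m, f ε (T^[cubeDot i ε] x)

/-- A measure is nonatomic if every measurable set of positive measure has a measurable subset
of strictly smaller positive measure. (This is stronger than null singletons on a general
measurable space.) -/
def IsNonatomic {X : Type*} [MeasurableSpace X] (μ : Measure X) : Prop :=
  ∀ s : Set X, MeasurableSet s → 0 < μ s →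
    ∃ t : Set X, t ⊆ s ∧ MeasurableSet t ∧ 0 < μ t ∧ μ t < μ s

/-!
All the functions `F ε` can be taken equal to one function `f ≥ 1`, and a single term of the cube
average already makes it large. For `i = (j, 1, …, 1)` the `2 ^ (m - 1)` exponents `i ⬝ ε` with
`ε 0 = 1` all lie in `{j, …, j + m - 1}`. Hence, if `f ≥ H` at `m` consecutive points of the orbit
of `x`, starting at a time `j ∈ {1, …, n}`, the average with `N = n` is at least
`H ^ (2 ^ (m - 1)) / n ^ m` (`le_cubeAverage`).

It remains to arrange such runs for almost every `x` and arbitrarily large `n`, with `H` a little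
larger than `n ^ (m / 2 ^ (m - 1))`. Nonatomicity and ergodicity give sets `C` of measure
`O(1 / n)` in which almost every orbit has a run of length `m` starting in `{1, …, n}`
(`exists_measurableSet_forall_hit_run`, by a weak form of the Rokhlin lemma). Making `f ≥ H` on
`C` costs `H ^ p * μ C`, about `n ^ (p * m / 2 ^ (m - 1) - 1)`, which is summable along a sparse
sequence of `n` as soon as `p < 2 ^ (m - 1) / m` (`exists_height`, `exists_memLp_ge_on`).
The bound `(2 ^ (m - 1) + 1) / (m + 1)` is at most `2 ^ (m - 1) / m` because `m ≤ 2 ^ (m - 1)`.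
-/

/-! ### Small sets visited by almost every orbit -/

/-- A nonatomic probability measure has sets of arbitrarily small positive measure. -/
theorem IsNonatomic.exists_measure_le {X : Type*} [MeasurableSpace X] {μ : Measure X}
    [IsProbabilityMeasure μ] (hμ : IsNonatomic μ) {δ : ENNReal} (hδ : δ ≠ 0) :
    ∃ A, MeasurableSet A ∧ 0 < μ A ∧ μ A ≤ δ := by
  have key : ∀ k : ℕ, ∃ A, MeasurableSet A ∧ 0 < μ A ∧ μ A ≤ 2⁻¹ ^ k := by
    intro k
    induction k with
    | zero => exact ⟨Set.univ, MeasurableSet.univ, by simp, by simp⟩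
    | succ k ih =>
      obtain ⟨A, hA, hpos, hle⟩ := ih
      obtain ⟨t, htA, ht, htpos, htlt⟩ := hμ A hA hpos
      have hsum : μ t + μ (A \ t) = μ A := by
        rw [← measure_inter_add_sdiff A ht, Set.inter_eq_right.2 htA]
      have hhalf : (2⁻¹ : ENNReal) ^ (k + 1) + 2⁻¹ ^ (k + 1) = 2⁻¹ ^ k := by
        rw [pow_succ, ← mul_add, ENNReal.inv_two_add_inv_two, mul_one]
      -- One of the two pieces `t` and `A \ t` carries at most half of the mass of `A`.
      by_cases h : μ t ≤ 2⁻¹ ^ (k + 1)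
      · exact ⟨t, ht, htpos, h⟩
      · refine ⟨A \ t, hA.diff ht, ?_, ?_⟩
        · rw [pos_iff_ne_zero]
          intro h0
          rw [h0, add_zero] at hsum
          exact htlt.ne hsum
        · by_contra h'
          push Not at h h'
          have := ENNReal.add_lt_add h h'
          rw [hhalf, hsum] at this
          exact absurd hle (not_le.2 this)
  obtain ⟨k, hk⟩ := ENNReal.exists_inv_two_pow_lt hδ
  obtain ⟨A, hA, hpos, hle⟩ := key k
  exact ⟨A, hA, hpos, hle.trans hk.le⟩

/-- Almost every orbit of an ergodic map visits a given set of positive measure. -/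
theorem Ergodic.ae_exists_iterate_mem {X : Type*} [MeasurableSpace X] {μ : Measure X}
    [IsFiniteMeasure μ] {T : X → X} (hT : Ergodic T μ) {A : Set X} (hA : MeasurableSet A)
    (hpos : 0 < μ A) : ∀ᵐ x ∂μ, ∃ j : ℕ, T^[j] x ∈ A := by
  have hS : MeasurableSet (⋃ j : ℕ, T^[j] ⁻¹' A) :=
    MeasurableSet.iUnion fun j => hT.measurable.iterate j hA
  have hsub : T ⁻¹' (⋃ j : ℕ, T^[j] ⁻¹' A) ⊆ ⋃ j : ℕ, T^[j] ⁻¹' A := by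
    intro x hx
    simp only [Set.mem_preimage, Set.mem_iUnion] at hx ⊢
    obtain ⟨j, hj⟩ := hx
    exact ⟨j + 1, by rwa [Function.iterate_succ_apply]⟩
  rcases hT.ae_empty_or_univ_of_preimage_ae_le hS.nullMeasurableSet hsub.eventuallyLE with h | h
  · have h0 : μ (⋃ j : ℕ, T^[j] ⁻¹' A) = 0 := by rw [measure_congr h, measure_empty]
    have : μ A ≤ μ (⋃ j : ℕ, T^[j] ⁻¹' A) :=
      measure_mono (Set.subset_iUnion (fun j : ℕ => T^[j] ⁻¹' A) 0)
    rw [h0] at this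
    exact absurd hpos (not_lt.2 this)
  · filter_upwards [eventuallyEq_univ.1 h] with x hx
    simpa using hx

/-- A substitute for the Rokhlin lemma: a set of measure at most `2 / n` that almost every orbit
visits among any `n` consecutive times. With `A` a set of measure at most `1 / n`, it is the union
of `A` and the points whose first hitting time of `A` lies in a residue class `c` modulo `n`,
chosen so that these points have measure at most `1 / n`. -/
theorem Ergodic.exists_measurableSet_forall_hit {X : Type*} [MeasurableSpace X] {μ : Measure X}
    [IsProbabilityMeasure μ] (hμ : IsNonatomic μ) {T : X → X} (hT : Ergodic T μ) {n : ℕ}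
    (hn : 0 < n) :
    ∃ B, MeasurableSet B ∧ μ.real B ≤ 2 / n ∧ ∀ᵐ x ∂μ, ∃ j < n, T^[j] x ∈ B := by
  have hn' : (0 : ℝ) < n := by exact_mod_cast hn
  obtain ⟨A, hA, hApos, hAle⟩ :=
    hμ.exists_measure_le (δ := ENNReal.ofReal (1 / n)) (by simpa using hn.ne')
  have hAle' : μ.real A ≤ 1 / n := ENNReal.toReal_le_of_le_ofReal (by positivity) hAle
  let E : ℕ → Set X := fun q => {x | T^[q] x ∈ A ∧ ∀ i < q, T^[i] x ∉ A}
  let D : ℕ → Set X := fun c => ⋃ q : ℕ, ⋃ _ : q % n = c, E q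
  have hE : ∀ q, MeasurableSet (E q) := by
    intro q
    have : E q = T^[q] ⁻¹' A ∩ ⋂ i : ℕ, ⋂ _ : i < q, (T^[i] ⁻¹' A)ᶜ := by
      ext x; simp [E]
    rw [this]
    exact (hT.measurable.iterate q hA).inter
      (MeasurableSet.iInter fun i => MeasurableSet.iInter fun _ =>
        (hT.measurable.iterate i hA).compl)
  have hD : ∀ c, MeasurableSet (D c) := fun c =>
    MeasurableSet.iUnion fun q => MeasurableSet.iUnion fun _ => hE q
  have hDdisj : Pairwise (Function.onFun Disjoint D) := by
    intro c c' hcc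
    rw [Function.onFun, Set.disjoint_left]
    intro x hx hx'
    simp only [D, Set.mem_iUnion] at hx hx'
    obtain ⟨q, hq, hxq, hxq'⟩ := hx
    obtain ⟨r, hr, hxr, hxr'⟩ := hx'
    have : q = r := by
      rcases lt_trichotomy q r with h | h | h
      · exact absurd hxq (hxr' q h)
      · exact h
      · exact absurd hxr (hxq' r h)
    exact hcc (by rw [← hq, ← hr, this])
  obtain ⟨c, hc, hcle⟩ : ∃ c ∈ Finset.range n, μ.real (D c) ≤ 1 / n := by
    apply Finset.exists_le_of_sum_le (Finset.nonempty_range_iff.2 hn.ne')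
    rw [← measureReal_biUnion_finset (hDdisj.set_pairwise _) (fun c _ => hD c)
      (fun c _ => measure_ne_top μ (D c))]
    rw [Finset.sum_const, Finset.card_range, nsmul_eq_mul, mul_one_div_cancel hn'.ne']
    exact measureReal_le_one
  rw [Finset.mem_range] at hc
  refine ⟨A ∪ D c, hA.union (hD c), ?_, ?_⟩
  · calc μ.real (A ∪ D c) ≤ μ.real A + μ.real (D c) := measureReal_union_le _ _
      _ ≤ 1 / n + 1 / n := add_le_add hAle' hcle
      _ = 2 / n := by ring
  · filter_upwards [hT.ae_exists_iterate_mem hA hApos] with x hx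
    classical
    have hr := Nat.find_spec hx
    have hmin : ∀ i < Nat.find hx, T^[i] x ∉ A := fun i hi => Nat.find_min hx hi
    set r := Nat.find hx
    rcases lt_or_ge r c with h | h
    · exact ⟨r, h.trans hc, Or.inl hr⟩
    · refine ⟨(r - c) % n, Nat.mod_lt _ hn, Or.inr ?_⟩
      -- After `j` steps the hitting time has dropped from `r` to `r - j`.
      have hj : (r - c) % n ≤ r - c := Nat.mod_le _ _
      have hdm := Nat.mod_add_div (r - c) n
      simp only [D, Set.mem_iUnion]
      refine ⟨r - (r - c) % n, ?_, ?_, ?_⟩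
      · have : r - (r - c) % n = c + n * ((r - c) / n) := by omega
        rw [this, Nat.add_mul_mod_self_left, Nat.mod_eq_of_lt hc]
      · rw [← Function.iterate_add_apply, Nat.sub_add_cancel (by omega)]
        exact hr
      · intro i hi
        rw [← Function.iterate_add_apply]
        exact hmin _ (by omega)

/-- The sets along which `F` is large: `C` has measure at most `2m / n`, and almost every orbit
spends `m` consecutive times in `C`, starting at one of the times `1, …, n`. -/
theorem exists_measurableSet_forall_hit_run {X : Type*} [MeasurableSpace X] {μ : Measure X}
    [IsProbabilityMeasure μ] (hμ : IsNonatomic μ) {T : X ≃ᵐ X} (hT : Ergodic T μ) (m : ℕ) {n : ℕ}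
    (hn : 0 < n) :
    ∃ C, MeasurableSet C ∧ μ.real C ≤ 2 * m / n ∧
      ∀ᵐ x ∂μ, ∃ j ∈ Finset.Icc 1 n, ∀ l < m, T^[j + l] x ∈ C := by
  obtain ⟨B, hB, hBle, hhit⟩ := hT.exists_measurableSet_forall_hit hμ hn
  have hsymm : MeasurePreserving T.symm μ μ := hT.toMeasurePreserving.symm T
  refine ⟨⋃ l ∈ Finset.range m, T.symm^[l] ⁻¹' B,
    Finset.measurableSet_biUnion _ fun l _ => hsymm.measurable.iterate l hB, ?_, ?_⟩
  · calc μ.real (⋃ l ∈ Finset.range m, T.symm^[l] ⁻¹' B)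
        ≤ ∑ l ∈ Finset.range m, μ.real (T.symm^[l] ⁻¹' B) := measureReal_biUnion_finset_le _ _
      _ = ∑ l ∈ Finset.range m, μ.real B := Finset.sum_congr rfl fun l _ =>
          (hsymm.iterate l).measureReal_preimage hB.nullMeasurableSet
      _ = m * μ.real B := by simp
      _ ≤ m * (2 / n) := by gcongr
      _ = 2 * m / n := by ring
  -- Starting from `T x` instead of `x` makes the visiting time of `x` at least `1`.
  · filter_upwards [hT.toMeasurePreserving.quasiMeasurePreserving.ae hhit] with x hx
    obtain ⟨j, hj, hjB⟩ := hx
    refine ⟨j + 1, Finset.mem_Icc.2 ⟨by omega, by omega⟩, fun l hl => ?_⟩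
    simp only [Set.mem_iUnion, Finset.mem_range, Set.mem_preimage]
    refine ⟨l, hl, ?_⟩
    rw [add_comm (j + 1) l, Function.iterate_add_apply,
      Function.LeftInverse.iterate T.symm_apply_apply l, Function.iterate_succ_apply]
    exact hjB

/-! ### Heights and the dominating function -/

/-- The choice of scales: as `p * m < D`, the height `H = (k n ^ m) ^ (1 / D)` satisfies
`H ^ p = o(n)` as `n → ∞`. -/
theorem exists_height {p : ℝ} {m D : ℕ} (hD : 0 < D) (hp : p * m < D) (c : ℝ) (k : ℕ) :
    ∃ n : ℕ, 0 < n ∧ k ≤ n ∧ ∃ H : ℝ, 0 ≤ H ∧ k * (n : ℝ) ^ m ≤ H ^ D ∧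
      H ^ p * (c / n) ≤ (1 / 2) ^ k := by
  have hD' : (0 : ℝ) < D := by exact_mod_cast hD
  let a : ℝ := 1 - p * m / D
  have ha : 0 < a := sub_pos.2 ((div_lt_one hD').2 hp)
  have hlim : Tendsto (fun n : ℕ => c * (k : ℝ) ^ (p / D) * (n : ℝ) ^ (-a)) atTop (nhds 0) := by
    simpa using ((tendsto_rpow_neg_atTop ha).comp tendsto_natCast_atTop_atTop).const_mul
      (c * (k : ℝ) ^ (p / D))
  obtain ⟨n, hle, hkn, hn⟩ := ((hlim.eventually_le_const (by positivity : (0 : ℝ) < (1 / 2) ^ k)).and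
    ((eventually_ge_atTop k).and (eventually_gt_atTop 0))).exists
  have hn' : (0 : ℝ) < n := by exact_mod_cast hn
  have hbase : (0 : ℝ) ≤ k * (n : ℝ) ^ m := by positivity
  refine ⟨n, hn, hkn, (k * (n : ℝ) ^ m) ^ (D : ℝ)⁻¹, by positivity, ?_, ?_⟩
  · rw [Real.rpow_inv_natCast_pow hbase hD.ne']
  · refine le_trans (le_of_eq ?_) hle
    rw [← Real.rpow_mul hbase, Real.mul_rpow (by positivity) (by positivity),
      ← Real.rpow_natCast_mul hn'.le]
    have hexp : -a = m * ((D : ℝ)⁻¹ * p) - 1 := by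
      simp only [a]; field_simp; ring
    rw [hexp, Real.rpow_sub_one hn'.ne', show p / D = (D : ℝ)⁻¹ * p by ring]
    ring

/-- If `∑ H k ^ p * μ (C k)` converges, a single function of `L ^ p`, bounded below by `1`,
dominates `H k` on `C k` for all `k` simultaneously. -/
theorem exists_memLp_ge_on {X : Type*} [MeasurableSpace X] {μ : Measure X} [IsFiniteMeasure μ]
    {p : ℝ} (hp : 0 < p) {H : ℕ → ℝ} (hH : ∀ k, 0 ≤ H k) {C : ℕ → Set X}
    (hC : ∀ k, MeasurableSet (C k)) (hsum : ∀ k, H k ^ p * μ.real (C k) ≤ (1 / 2) ^ k) :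
    ∃ f : X → ℝ, MemLp f (ENNReal.ofReal p) μ ∧ (∀ x, 1 ≤ f x) ∧
      ∀ᵐ x ∂μ, ∀ k, x ∈ C k → H k ≤ f x := by
  let G : X → ENNReal := fun x => ∑' k, (C k).indicator (fun _ => ENNReal.ofReal (H k ^ p)) x
  have hGm : Measurable G :=
    Measurable.tsum fun k => measurable_const.indicator (hC k)
  have hGint : ∫⁻ x, G x ∂μ ≠ ⊤ := by
    have hle : ∫⁻ x, G x ∂μ ≤ ∑' k : ℕ, ENNReal.ofReal ((1 / 2) ^ k) := by
      rw [lintegral_tsum fun k => (measurable_const.indicator (hC k)).aemeasurable]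
      refine ENNReal.tsum_le_tsum fun k => ?_
      rw [lintegral_indicator_const (hC k), ← ofReal_measureReal,
        ← ENNReal.ofReal_mul (Real.rpow_nonneg (hH k) p)]
      exact ENNReal.ofReal_le_ofReal (hsum k)
    refine ne_top_of_le_ne_top ?_ hle
    exact summable_geometric_two.tsum_ofReal_ne_top
  have hGfin : ∀ᵐ x ∂μ, G x < ⊤ := ae_lt_top hGm hGint
  have hGi : Integrable (fun x => (G x).toReal) μ :=
    integrable_toReal_of_lintegral_ne_top hGm.aemeasurable hGint
  have h1 : ∀ x, 1 ≤ 1 + (G x).toReal := fun x => le_add_of_nonneg_right ENNReal.toReal_nonneg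
  have h0 : ∀ x, 0 ≤ 1 + (G x).toReal := fun x => zero_le_one.trans (h1 x)
  refine ⟨fun x => (1 + (G x).toReal) ^ p⁻¹, ?_, fun x => ?_, ?_⟩
  · rw [← integrable_norm_rpow_iff _ (by simpa using hp) ENNReal.ofReal_ne_top]
    · rw [ENNReal.toReal_ofReal hp.le]
      refine ((integrable_const (1 : ℝ)).add hGi).congr (Eventually.of_forall fun x => ?_)
      simp only [Pi.add_apply]
      rw [Real.norm_of_nonneg (Real.rpow_nonneg (h0 x) _), Real.rpow_inv_rpow (h0 x) hp.ne']
    · exact ((measurable_const.add hGm.ennreal_toReal).pow_const _).aestronglyMeasurable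
  · exact Real.one_le_rpow (h1 x) (by positivity)
  · filter_upwards [hGfin] with x hx k hk
    rw [Real.le_rpow_inv_iff_of_pos (hH k) (h0 x) hp]
    have : ENNReal.ofReal (H k ^ p) ≤ G x := by
      refine le_trans ?_ (ENNReal.le_tsum k)
      rw [Set.indicator_of_mem hk]
    have := (ENNReal.ofReal_le_iff_le_toReal hx.ne).1 this
    linarith

/-! ### A lower bound for the cube average -/

/-- Among the vertices of the cube, half of `2 ^ (d + 1)` have first coordinate `1`. -/
theorem card_cubeVertex_filter (d : ℕ) :
    (Finset.univ.filter fun ε : CubeVertex (d + 1) => ε.1 0 = 1).card = 2 ^ d := by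
  have : (2 : ℕ) ^ d = (Finset.univ : Finset (Fin d → Fin 2)).card := by simp
  rw [this]
  symm
  refine Finset.card_bij
    (fun e _ => ⟨Fin.cons 1 e, fun h => by simpa using congrFun h 0⟩) ?_ ?_ ?_
  · intro e _
    simp
  · intro e _ e' _ h
    exact (Fin.cons_injective2 (α := fun _ => Fin 2) (Subtype.ext_iff.1 h)).2
  · intro ε hε
    refine ⟨Fin.tail ε.1, Finset.mem_univ _, Subtype.ext ?_⟩
    simp only [Finset.mem_filter, Finset.mem_univ, true_and] at hε
    show Fin.cons 1 (Fin.tail ε.1) = ε.1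
    rw [← hε, Fin.cons_self_tail]

/-- If the orbit of `x` has a run of `d + 1` consecutive values at least `H`, starting at a time
`j ≤ N`, then the single term `i = (j, 1, …, 1)` of the cube average is at least `H ^ (2 ^ d)`:
the exponents `i ⬝ ε` of the vertices with `ε 0 = 1` all lie in that run. -/
theorem le_cubeAverage {X : Type*} {T : X → X} {d N : ℕ} {f : X → ℝ} (hf : ∀ x, 1 ≤ f x) {x : X}
    {H : ℝ} (hH : 0 ≤ H) {j : ℕ} (hj : j ∈ Finset.Icc 1 N)
    (hrun : ∀ l < d + 1, H ≤ f (T^[j + l] x)) :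
    H ^ 2 ^ d / (N : ℝ) ^ (d + 1) ≤ cubeAverage T (d + 1) (fun _ => f) N x := by
  have hf0 : ∀ x, 0 ≤ f x := fun x => zero_le_one.trans (hf x)
  rw [cubeAverage, div_eq_mul_one_div, mul_comm]
  gcongr
  let i : Fin (d + 1) → ℕ := Fin.cons j fun _ => 1
  have hi : i ∈ Fintype.piFinset (fun _ : Fin (d + 1) => Finset.Icc 1 N) := by
    rw [Finset.mem_Icc] at hj
    rw [Fintype.mem_piFinset]
    intro a
    rw [Finset.mem_Icc]
    refine Fin.cases ?_ (fun b => ?_) a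
    · simpa [i] using hj
    · simp only [i, Fin.cons_succ]
      omega
  calc H ^ 2 ^ d = ∏ ε : CubeVertex (d + 1), if ε.1 0 = 1 then H else 1 := by
        rw [Finset.prod_ite, Finset.prod_const, Finset.prod_const_one, mul_one,
          card_cubeVertex_filter]
    _ ≤ ∏ ε : CubeVertex (d + 1), f (T^[cubeDot i ε] x) := by
        refine Finset.prod_le_prod (fun ε _ => by split_ifs <;> positivity) fun ε _ => ?_
        split_ifs with h
        · have hdot : cubeDot i ε = j + ∑ b : Fin d, (ε.1 b.succ : ℕ) := by
            simp [cubeDot, Fin.sum_univ_succ, i, h]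
          have hle : ∑ b : Fin d, (ε.1 b.succ : ℕ) ≤ d := by
            calc ∑ b : Fin d, (ε.1 b.succ : ℕ) ≤ ∑ _b : Fin d, 1 :=
                  Finset.sum_le_sum fun b _ => by omega
              _ = d := by simp
          rw [hdot]
          exact hrun _ (by omega)
        · exact hf _
    _ ≤ _ := Finset.single_le_sum
        (f := fun i => ∏ ε : CubeVertex (d + 1), f (T^[cubeDot i ε] x))
        (fun i _ => Finset.prod_nonneg fun ε _ => hf0 _) hi

/-! ### Divergence of the cube averages -/

theorem theorem3 (m : ℕ) (hm : 3 ≤ m) (p : ℝ) (hp0 : 0 < p)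
    (hp : p < ((2 : ℝ) ^ (m - 1) + 1) / ((m : ℝ) + 1))
    {X : Type*} [MeasurableSpace X] (μ : Measure X) [IsProbabilityMeasure μ]
    (hμ : IsNonatomic μ) (T : X ≃ᵐ X) (hT : Ergodic T μ) :
    ∃ F : CubeVertex m → X → ℝ,
      (∀ ε, MemLp (F ε) (ENNReal.ofReal p) μ) ∧
      ∀ᵐ x ∂μ,
        limsup (fun N : ℕ => ((cubeAverage T m F N x : ℝ) : EReal)) atTop = ⊤ := by
  obtain ⟨d, rfl⟩ : ∃ d, m = d + 1 := ⟨m - 1, by omega⟩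
  rw [Nat.add_sub_cancel] at hp
  have hpm : p * (d + 1 : ℕ) < (2 ^ d : ℕ) := by
    have hd : ((d + 1 : ℕ) : ℝ) ≤ 2 ^ d := by exact_mod_cast Nat.lt_two_pow_self
    have hd0 : (0 : ℝ) < (d + 1 : ℕ) := by positivity
    rw [lt_div_iff₀ (by positivity)] at hp
    push_cast at hp hd hd0 ⊢
    nlinarith
  choose n hn hkn H hH hHD hHp using exists_height (by positivity) hpm (2 * (d + 1 : ℕ))
  choose C hC hCle hCrun using fun k =>
    exists_measurableSet_forall_hit_run hμ hT (d + 1) (hn k)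
  obtain ⟨f, hfp, hf1, hfC⟩ := exists_memLp_ge_on hp0 hH hC fun k =>
    (mul_le_mul_of_nonneg_left (hCle k) (Real.rpow_nonneg (hH k) p)).trans (hHp k)
  refine ⟨fun _ => f, fun _ => hfp, ?_⟩
  have horbit : ∀ᵐ x ∂μ, ∀ j : ℕ, ∀ k, T^[j] x ∈ C k → H k ≤ f (T^[j] x) :=
    ae_all_iff.2 fun j =>
      (hT.toMeasurePreserving.iterate j).quasiMeasurePreserving.ae hfC
  filter_upwards [horbit, ae_all_iff.2 hCrun] with x hxf hxC
  have hlarge : ∀ k : ℕ, (k : ℝ) ≤ cubeAverage T (d + 1) (fun _ => f) (n k) x := by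
    intro k
    obtain ⟨j, hj, hrun⟩ := hxC k
    refine le_trans ?_ (le_cubeAverage hf1 (hH k) hj fun l hl => hxf _ k (hrun l hl))
    rw [le_div_iff₀ (pow_pos (by exact_mod_cast hn k) _)]
    exact hHD k
  rw [EReal.eq_top_iff_forall_lt]
  intro y
  refine lt_of_lt_of_le (EReal.coe_lt_coe_iff.2 (lt_add_one y))
    (le_limsup_of_frequently_le' (frequently_atTop.2 fun a => ?_))
  obtain ⟨b, hb⟩ := exists_nat_ge (y + 1)
  refine ⟨n (max a b), (le_max_left a b).trans (hkn _), ?_⟩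
  rw [EReal.coe_le_coe_iff]
  exact (hb.trans (Nat.cast_le.2 (le_max_right a b))).trans (hlarge _)
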